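/- **Bottleneck Theorem.** An *orthant of rank* $k$ in $\mathbb Z^N$ is a set $\tau(\langle Y\rangle)$, where $\langle Y\rangle$ is the monoid generated by a set $Y$ of $k$ canonical basis vectors and $\tau(x)=a+Ax$ with $a\in\mathbb Z^N$ and $A\in O(N,\mathbb Z)$. A subset of $\mathbb Z^N$ is *orthohedral* if it is a finite union of orthants; the *rank* ${\rm rk}(T)$ of a set $T\subseteq\mathbb Z^N$ is the maximal rank of an orthant contained in $T$, with ${\rm rk}(\emptyset)=-1$. Let $S\subseteq\mathbb Z^N$ be an orthohedral set and let $G={\rm pei}(S)$ be the group of all permutations $g$ of $S$ such that $S$ is a finite disjoint union of orthants on each of which $g$ restricts to an isometric embedding (the restriction of a map $x\mapsto a+Ax$ as above). The *support* of $g\in G$ is the union of all orthants $L\subseteq S$ on which $g$ restricts to an isometric embedding different from ${\rm id}_L$, and ${\rm rk}(g)$ is the rank of the support of $g$; the rank ${\rm rk}(N)$ of a subgroup $N\leqslant G$ is the maximal rank of its elements. Let $G_k=\{g\in G\mid {\rm rk}(g)\le k\}$ for $k\ge -1$ (so $G_{-1}=1$). An *orthant-transposition of rank* $k$ is an element of $G$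 which, for some disjoint rank-$k$ orthants $L,L'\subseteq S$, maps $L$ isometrically onto $L'$, maps $L'$ onto $L$ by the inverse isometry, and fixes all other points of $S$. Let ${\rm alt}\,G_k\leqslant G_k$ be the subgroup of all products of an even number of orthant-transpositions of rank $k$ (so ${\rm alt}\,G_{-1}=1$; put also ${\rm alt}\,G_{-2}=1$). Then, for every normal subgroup $N$ of $G$, with $k={\rm rk}(N)$, $$ {\rm alt}\,G_{k-1}\;\leqslant\; N\;\leqslant\; G_k .$$ -/

import Mathlib

/-!
Piecewise Euclidean isometries of orthohedral subsets of the lattice `ℤ^N = Fin N → ℤ`.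
-/

namespace Pei

open Matrix

/-- `τ` is an affine-orthogonal transformation `x ↦ a + A x` of `ℤ^N`, with `A ∈ O(N, ℤ)` and
`a ∈ ℤ^N`; these maps form the group of Euclidean isometries of `ℤ^N`. -/
def IsLatticeIsometry {N : ℕ} (τ : (Fin N → ℤ) → (Fin N → ℤ)) : Prop :=
  ∃ A ∈ Matrix.orthogonalGroup (Fin N) ℤ, ∃ a : Fin N → ℤ, ∀ x, τ x = a + A *ᵥ x

/-- The monoid generated by the canonical basis vectors with index in `Y`, that is, a face of the
standard orthant `ℕ^N`. -/
def face {N : ℕ} (Y : Finset (Fin N)) : Set (Fin N → ℤ) :=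
  {x | ∀ i, 0 ≤ x i ∧ (i ∉ Y → x i = 0)}

/-- `L` is an (integral) orthant of rank `k` in `ℤ^N`: the image of a `k`-dimensional face of the
standard orthant under an affine-orthogonal transformation. -/
def IsOrthant {N : ℕ} (k : ℕ) (L : Set (Fin N → ℤ)) : Prop :=
  ∃ τ, IsLatticeIsometry τ ∧ ∃ Y : Finset (Fin N), Y.card = k ∧ L = τ '' face Y

/-- `S` is orthohedral: a finite union of orthants. -/
def IsOrthohedral {N : ℕ} (S : Set (Fin N → ℤ)) : Prop :=
  ∃ Λ : Set (Set (Fin N → ℤ)), Λ.Finite ∧ (∀ L ∈ Λ, ∃ k, IsOrthant k L) ∧ ⋃₀ Λ = S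

/-- The rank of a subset of `ℤ^N`: the maximal rank of an orthant contained in it, with the
convention that the empty set has rank `-1`. -/
noncomputable def rk {N : ℕ} (T : Set (Fin N → ℤ)) : ℤ :=
  sSup {r : ℤ | r = -1 ∨ ∃ k : ℕ, r = k ∧ ∃ L, IsOrthant k L ∧ L ⊆ T}

/-- The permutation `g` of `S` restricts on `L` (a subset of `S`) to an isometric embedding. -/
def IsometricOn {N : ℕ} {S : Set (Fin N → ℤ)} (g : Equiv.Perm S) (L : Set (Fin N → ℤ)) : Prop :=
  ∃ τ, IsLatticeIsometry τ ∧ ∀ x : S, (x : Fin N → ℤ) ∈ L → (g x : Fin N → ℤ) = τ x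

/-- `g` is a piecewise Euclidean isometric permutation of `S`: the set `S` is a finite disjoint
union of orthants on each of which `g` restricts to an isometric embedding. -/
def IsPei {N : ℕ} {S : Set (Fin N → ℤ)} (g : Equiv.Perm S) : Prop :=
  ∃ Λ : Set (Set (Fin N → ℤ)), Λ.Finite ∧ (∀ L ∈ Λ, ∃ k, IsOrthant k L) ∧
    Λ.PairwiseDisjoint id ∧ ⋃₀ Λ = S ∧ ∀ L ∈ Λ, IsometricOn g L

/-- The support of a permutation `g` of `S`: the union of all orthants in `S` on which `g`
restricts to an isometric embedding different from the identity. -/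
def supp {N : ℕ} {S : Set (Fin N → ℤ)} (g : Equiv.Perm S) : Set (Fin N → ℤ) :=
  ⋃₀ {L | (∃ k, IsOrthant k L) ∧ L ⊆ S ∧ IsometricOn g L ∧ ∃ x : S, (x : Fin N → ℤ) ∈ L ∧ g x ≠ x}

/-- `g` is an orthant-transposition of rank `k`: there are disjoint rank-`k` orthants `L`, `L'`
in `S` such that `g` maps `L` isometrically onto `L'`, maps `L'` back by the inverse isometry, and
fixes every other point. -/
def IsOrthantTransposition {N : ℕ} {S : Set (Fin N → ℤ)} (k : ℕ) (g : Equiv.Perm S) : Prop :=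
  ∃ L L' : Set (Fin N → ℤ), IsOrthant k L ∧ IsOrthant k L' ∧ L ⊆ S ∧ L' ⊆ S ∧ Disjoint L L' ∧
    IsometricOn g L ∧
    (∀ x : S, (x : Fin N → ℤ) ∈ L → (g x : Fin N → ℤ) ∈ L') ∧
    (∀ x : S, (x : Fin N → ℤ) ∈ L' → (g x : Fin N → ℤ) ∈ L) ∧
    (∀ x : S, (x : Fin N → ℤ) ∈ L ∪ L' → g (g x) = x) ∧
    (∀ x : S, (x : Fin N → ℤ) ∉ L ∪ L' → g x = x)

/-! ### Auxiliary facts: the pei-permutations and the rank subgroups are groups -/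

section Aux

variable {N : ℕ}

theorem signedPerm {A : Matrix (Fin N) (Fin N) ℤ} (hA : A ∈ Matrix.orthogonalGroup (Fin N) ℤ) :
    ∃ (σ : Equiv.Perm (Fin N)) (ε : Fin N → ℤ), (∀ i, ε i = 1 ∨ ε i = -1) ∧
      ∀ v i, (A *ᵥ v) i = ε i * v (σ i) := by
  have h1 : A * Aᵀ = 1 := (Matrix.mem_orthogonalGroup_iff (Fin N) ℤ).1 hA
  have hrow : ∀ i j, ∑ l, A i l * A j l = if i = j then 1 else 0 := by
    intro i j
    have := congrFun (congrFun h1 i) j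
    simpa [Matrix.mul_apply, Matrix.one_apply] using this
  have hex : ∀ i, ∃ j, (A i j = 1 ∨ A i j = -1) ∧ ∀ l, l ≠ j → A i l = 0 := by
    intro i
    have hi := hrow i i
    simp only [if_true] at hi
    have hne : ∃ j, A i j ≠ 0 := by
      by_contra! h
      simp [h] at hi
    obtain ⟨j, hj⟩ := hne
    have hj1 : 1 ≤ A i j * A i j := by
      have := mul_self_pos.2 hj
      omega
    have hsplit := Finset.add_sum_erase Finset.univ (fun l => A i l * A i l) (Finset.mem_univ j)
    have hnn : ∀ l ∈ Finset.univ.erase j, 0 ≤ A i l * A i l := fun l _ => mul_self_nonneg _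
    have hs0 := Finset.sum_nonneg hnn
    have hz : ∑ l ∈ Finset.univ.erase j, A i l * A i l = 0 := by omega
    refine ⟨j, mul_self_eq_one_iff.1 (by omega), fun l hl => ?_⟩
    have := (Finset.sum_eq_zero_iff_of_nonneg hnn).1 hz l (by simp [hl])
    simpa using this
  choose σ hσ hσ0 using hex
  have hinj : Function.Injective σ := by
    intro i j hij
    by_contra hne
    have h := hrow i j
    rw [if_neg hne, Finset.sum_eq_single (σ i)] at h
    · have h2 := hσ j
      rw [← hij] at h2
      rcases hσ i with h3 | h3 <;> rcases h2 with h4 | h4 <;> simp [h3, h4] at h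
    · intro l _ hl
      simp [hσ0 i l hl]
    · simp
  refine ⟨Equiv.ofBijective σ (Finite.injective_iff_bijective.1 hinj), fun i => A i (σ i), hσ, ?_⟩
  intro v i
  simp only [Matrix.mulVec, dotProduct, Equiv.ofBijective_apply]
  rw [Finset.sum_eq_single (σ i)]
  · intro l _ hl
    simp [hσ0 i l hl]
  · simp

/-- The orthant with base `a` and direction signs `s`. -/
def box (a s : Fin N → ℤ) : Set (Fin N → ℤ) :=
  {x | ∀ i, (s i = 0 → x i = a i) ∧ 0 ≤ s i * (x i - a i)}

/-- A sign vector. -/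
def IsSign (s : Fin N → ℤ) : Prop := ∀ i, s i = 0 ∨ s i = 1 ∨ s i = -1

theorem isOrthant_box (a : Fin N → ℤ) {s : Fin N → ℤ} (hs : IsSign s) :
    IsOrthant (Finset.univ.filter fun i => s i ≠ 0).card (box a s) := by
  let d : Fin N → ℤ := fun i => if s i = 0 then 1 else s i
  have hd : ∀ i, d i * d i = 1 := by
    intro i
    rcases hs i with h | h | h <;> simp [d, h]
  refine ⟨fun x => a + Matrix.diagonal d *ᵥ x, ⟨Matrix.diagonal d, ?_, a, fun x => rfl⟩,
    Finset.univ.filter fun i => s i ≠ 0, rfl, ?_⟩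
  · rw [Matrix.mem_orthogonalGroup_iff]
    ext i j
    by_cases hij : i = j
    · subst hij
      simp [hd]
    · simp [hij]
  · ext x
    constructor
    · intro hx
      refine ⟨fun i => s i * (x i - a i), fun i => ⟨(hx i).2, fun hi => ?_⟩, ?_⟩
      · have : s i = 0 := by simpa using hi
        simp [this]
      · ext i
        have h := hx i
        rcases hs i with h0 | h0 | h0 <;> simp [Matrix.mulVec_diagonal, d, h0] at h ⊢
        omega
    · rintro ⟨v, hv, rfl⟩ i
      have h := hv i
      rcases hs i with h0 | h0 | h0 <;> simp [Matrix.mulVec_diagonal, d, h0] at h ⊢ <;> omega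

theorem IsOrthant.exists_box {k : ℕ} {L : Set (Fin N → ℤ)} (h : IsOrthant k L) :
    ∃ a s, IsSign s ∧ (Finset.univ.filter fun i => s i ≠ 0).card = k ∧ L = box a s := by
  obtain ⟨τ, ⟨A, hA, a, hτ⟩, Y, hY, rfl⟩ := h
  obtain ⟨σ, ε, hε, hAv⟩ := signedPerm hA
  have hε0 : ∀ i, ε i ≠ 0 := fun i => by rcases hε i with h | h <;> simp [h]
  refine ⟨a, fun i => if σ i ∈ Y then ε i else 0, ?_, ?_, ?_⟩
  · intro i
    rcases hε i with h | h <;> by_cases hi : σ i ∈ Y <;> simp [h, hi]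
  · rw [← hY]
    refine Finset.card_bij (fun i _ => σ i) ?_ (fun i _ j _ hij => σ.injective hij) ?_
    · intro i hi
      by_contra hc
      simp [hc] at hi
    · intro j hj
      exact ⟨σ.symm j, by simp [hj, hε0], by simp⟩
  · ext x
    constructor
    · rintro ⟨v, hv, rfl⟩ i
      have h := hv (σ i)
      rw [hτ]
      simp only [Pi.add_apply, hAv]
      by_cases hi : σ i ∈ Y <;> rcases hε i with h0 | h0 <;> simp [hi, h0] at h ⊢ <;> omega
    · intro hx
      refine ⟨fun j => ε (σ.symm j) * (x (σ.symm j) - a (σ.symm j)), fun j => ?_, ?_⟩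
      · have h := hx (σ.symm j)
        by_cases hi : j ∈ Y <;> simp [hi] at h ⊢ <;> simp [h]
      · ext i
        rw [hτ]
        simp only [Pi.add_apply, hAv]
        rcases hε i with h0 | h0 <;> simp [h0]

theorem IsOrthant.le {k : ℕ} {L : Set (Fin N → ℤ)} (h : IsOrthant k L) : k ≤ N := by
  obtain ⟨_, _, Y, rfl, _⟩ := h
  simpa using Finset.card_le_univ Y

theorem isLatticeIsometry_id : IsLatticeIsometry (N := N) id :=
  ⟨1, one_mem _, 0, by simp⟩

theorem IsLatticeIsometry.comp {τ τ' : (Fin N → ℤ) → (Fin N → ℤ)} (h : IsLatticeIsometry τ)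
    (h' : IsLatticeIsometry τ') : IsLatticeIsometry (τ ∘ τ') := by
  obtain ⟨A, hA, a, h⟩ := h
  obtain ⟨A', hA', a', h'⟩ := h'
  refine ⟨A * A', mul_mem hA hA', a + A *ᵥ a', fun x => ?_⟩
  simp [h, h', Matrix.mulVec_add, Matrix.mulVec_mulVec, add_assoc]

theorem IsLatticeIsometry.exists_inv {τ : (Fin N → ℤ) → (Fin N → ℤ)} (h : IsLatticeIsometry τ) :
    ∃ ρ, IsLatticeIsometry ρ ∧ (∀ x, ρ (τ x) = x) ∧ ∀ x, τ (ρ x) = x := by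
  obtain ⟨A, hA, a, h⟩ := h
  have h1 : A * star A = 1 := (Matrix.mem_orthogonalGroup_iff (Fin N) ℤ).1 hA
  have h2 : star A * A = 1 := (Matrix.mem_orthogonalGroup_iff' (Fin N) ℤ).1 hA
  refine ⟨fun x => -(star A *ᵥ a) + star A *ᵥ x, ⟨star A, ?_, _, fun x => rfl⟩, ?_, ?_⟩
  · exact (Matrix.mem_orthogonalGroup_iff (Fin N) ℤ).2 h2
  · intro x
    simp [h, Matrix.mulVec_add, Matrix.mulVec_mulVec, h2]
  · intro x
    simp [h, Matrix.mulVec_add, Matrix.mulVec_neg, Matrix.mulVec_mulVec, h1]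

theorem IsOrthant.image {k : ℕ} {L : Set (Fin N → ℤ)} (hL : IsOrthant k L)
    {τ : (Fin N → ℤ) → (Fin N → ℤ)} (h : IsLatticeIsometry τ) : IsOrthant k (τ '' L) := by
  obtain ⟨τ', h', Y, hY, rfl⟩ := hL
  exact ⟨τ ∘ τ', h.comp h', Y, hY, by rw [Set.image_comp]⟩

theorem IsOrthant.nonempty {k : ℕ} {L : Set (Fin N → ℤ)} (hL : IsOrthant k L) : L.Nonempty := by
  obtain ⟨τ, _, Y, _, rfl⟩ := hL
  exact ⟨τ 0, 0, fun i => by simp, rfl⟩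

/-- The lattice is cut into finitely many disjoint orthants none of which crosses a member of a
given finite family of orthants. -/
theorem exists_grid {Λ : Set (Set (Fin N → ℤ))} (hfin : Λ.Finite)
    (hΛ : ∀ L ∈ Λ, ∃ k, IsOrthant k L) :
    ∃ C : Set (Set (Fin N → ℤ)), C.Finite ∧ (∀ c ∈ C, ∃ k, IsOrthant k c) ∧
      C.PairwiseDisjoint id ∧ ⋃₀ C = Set.univ ∧
      ∀ c ∈ C, ∀ L ∈ Λ, (c ∩ L).Nonempty → c ⊆ L := by
  have hex : ∀ L ∈ Λ, ∃ a s, IsSign s ∧ L = box a s := fun L hL => by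
    obtain ⟨k, hk⟩ := hΛ L hL
    obtain ⟨a, s, hs, _, h⟩ := hk.exists_box
    exact ⟨a, s, hs, h⟩
  choose! a s hs hbox using hex
  obtain ⟨M, hM0, hM⟩ : ∃ M : ℤ, 0 ≤ M ∧ ∀ L ∈ Λ, ∀ i, |a L i| ≤ M := by
    refine ⟨∑ L ∈ hfin.toFinset, ∑ i, |a L i|,
      Finset.sum_nonneg fun _ _ => Finset.sum_nonneg fun _ _ => abs_nonneg _, fun L hL i => ?_⟩
    calc |a L i| ≤ ∑ i, |a L i| :=
          Finset.single_le_sum (f := fun i => |a L i|) (fun _ _ => abs_nonneg _) (Finset.mem_univ i)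
      _ ≤ _ := Finset.single_le_sum (f := fun L => ∑ i, |a L i|)
          (fun _ _ => Finset.sum_nonneg fun _ _ => abs_nonneg _) (hfin.mem_toFinset.2 hL)
  let cl : (Fin N → ℤ) → (Fin N → ℤ) := fun x i => max (-(M + 1)) (min (M + 1) (x i))
  have hrange : (Set.range cl).Finite := by
    refine (Fintype.piFinset fun _ : Fin N => Finset.Icc (-(M + 1)) (M + 1)).finite_toSet.subset ?_
    rintro _ ⟨x, rfl⟩
    simp only [Finset.mem_coe, Fintype.mem_piFinset, Finset.mem_Icc, cl]
    intro i
    omega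
  refine ⟨(fun c => {x | cl x = c}) '' Set.range cl, hrange.image _, ?_, ?_, ?_, ?_⟩
  · rintro _ ⟨_, ⟨y, rfl⟩, rfl⟩
    have h := isOrthant_box (N := N) (cl y)
      (s := fun i => if cl y i = M + 1 then 1 else if cl y i = -(M + 1) then -1 else 0)
      (fun i => by dsimp only; split_ifs <;> simp)
    refine ⟨_, cast (congrArg _ ?_) h⟩
    ext x
    simp only [box, Set.mem_ofPred_eq, funext_iff]
    refine forall_congr' fun i => ?_
    simp only [cl]
    split_ifs <;>
      simp only [one_ne_zero, false_imp_iff, true_and, true_imp_iff, one_mul, zero_mul, le_refl,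
        and_true] <;> omega
  · rintro _ ⟨c, _, rfl⟩ _ ⟨d, _, rfl⟩ hne
    refine Set.disjoint_left.2 fun x hx hx' => hne ?_
    have : c = d := (show cl x = c from hx).symm.trans hx'
    rw [this]
  · refine Set.eq_univ_of_forall fun x => ⟨_, ⟨cl x, ⟨x, rfl⟩, rfl⟩, rfl⟩
  · rintro _ ⟨c, _, rfl⟩ L hL ⟨y, hy, hyL⟩ x hx
    rw [hbox L hL] at hyL ⊢
    intro i
    have h1 : cl x i = cl y i := congrFun ((show cl x = c from hx).trans
      (show cl y = c from hy).symm) i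
    have h2 := hyL i
    have h3 := abs_le.1 (hM L hL i)
    simp only [cl] at h1
    rcases hs L hL i with h0 | h0 | h0 <;> simp [h0] at h2 ⊢ <;> omega

theorem IsometricOn.mono {S : Set (Fin N → ℤ)} {g : Equiv.Perm S} {L L' : Set (Fin N → ℤ)}
    (h : IsometricOn g L) (hL : L' ⊆ L) : IsometricOn g L' := by
  obtain ⟨τ, hτ, hg⟩ := h
  exact ⟨τ, hτ, fun x hx => hg x (hL hx)⟩

theorem isPei_one {S : Set (Fin N → ℤ)} (hS : IsOrthohedral S) :
    IsPei (1 : Equiv.Perm S) := by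
  obtain ⟨Λ, hfin, hΛ, rfl⟩ := hS
  obtain ⟨C, hC, hCo, hCd, hCu, hCL⟩ := exists_grid hfin hΛ
  refine ⟨{c ∈ C | ∃ L ∈ Λ, c ⊆ L}, hC.subset fun c hc => hc.1, fun c hc => hCo c hc.1,
    hCd.subset fun c hc => hc.1, ?_, fun L _ => ⟨id, isLatticeIsometry_id, fun x _ => rfl⟩⟩
  ext x
  constructor
  · rintro ⟨c, ⟨_, L, hL, hcL⟩, hx⟩
    exact ⟨L, hL, hcL hx⟩
  · rintro ⟨L, hL, hx⟩
    obtain ⟨c, hc, hxc⟩ : x ∈ ⋃₀ C := hCu ▸ Set.mem_univ x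
    exact ⟨c, ⟨hc, L, hL, hCL c hc L hL ⟨x, hxc, hx⟩⟩, hxc⟩

theorem IsPei.inv {S : Set (Fin N → ℤ)} {g : Equiv.Perm S} (hg : IsPei g) : IsPei g⁻¹ := by
  obtain ⟨Λ, hfin, hΛ, hd, hu, hiso⟩ := hg
  choose! τ hτ hgτ using hiso
  have hsub : ∀ L ∈ Λ, L ⊆ S := fun L hL x hx => hu ▸ ⟨L, hL, hx⟩
  refine ⟨(fun L => τ L '' L) '' Λ, hfin.image _, ?_, ?_, ?_, ?_⟩
  · rintro _ ⟨L, hL, rfl⟩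
    obtain ⟨k, hk⟩ := hΛ L hL
    exact ⟨k, hk.image (hτ L hL)⟩
  · rintro _ ⟨L, hL, rfl⟩ _ ⟨L', hL', rfl⟩ hne
    refine Set.disjoint_left.2 ?_
    rintro _ ⟨x, hx, rfl⟩ ⟨y, hy, hxy⟩
    have h1 := hgτ L hL ⟨x, hsub L hL hx⟩ hx
    have h2 := hgτ L' hL' ⟨y, hsub L' hL' hy⟩ hy
    have h3 : g ⟨y, hsub L' hL' hy⟩ = g ⟨x, hsub L hL hx⟩ := Subtype.ext (by rw [h1, h2, hxy])
    have h4 : y = x := congrArg Subtype.val (g.injective h3)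
    subst h4
    have h5 : L = L' := by
      by_contra h
      exact Set.disjoint_left.1 (hd hL hL' h) hx hy
    exact hne (by rw [h5])
  · ext x
    constructor
    · rintro ⟨_, ⟨L, hL, rfl⟩, y, hy, rfl⟩
      rw [← hgτ L hL ⟨y, hsub L hL hy⟩ hy]
      exact (g _).2
    · intro hx
      obtain ⟨L, hL, hy⟩ : ((g⁻¹ ⟨x, hx⟩ : S) : Fin N → ℤ) ∈ ⋃₀ Λ := hu ▸ (g⁻¹ ⟨x, hx⟩ : S).2
      refine ⟨_, ⟨L, hL, rfl⟩, _, hy, ?_⟩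
      rw [← hgτ L hL _ hy]
      simp
  · rintro _ ⟨L, hL, rfl⟩
    obtain ⟨ρ, hρ, h1, _⟩ := (hτ L hL).exists_inv
    refine ⟨ρ, hρ, ?_⟩
    rintro ⟨_, hx⟩ ⟨y, hy, rfl⟩
    rw [h1]
    have h2 : (⟨τ L y, hx⟩ : S) = g ⟨y, hsub L hL hy⟩ :=
      Subtype.ext (hgτ L hL ⟨y, hsub L hL hy⟩ hy).symm
    rw [h2]
    simp

theorem IsPei.mul {S : Set (Fin N → ℤ)} {f g : Equiv.Perm S} (hf : IsPei f) (hg : IsPei g) :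
    IsPei (f * g) := by
  obtain ⟨Λ, hfin, hΛ, hd, hu, hiso⟩ := hg
  obtain ⟨Λ', hfin', hΛ', hd', hu', hiso'⟩ := hf
  choose! τ hτ hgτ using hiso
  choose! τ' hτ' hfτ' using hiso'
  have hinv : ∀ L ∈ Λ, ∃ ρ, IsLatticeIsometry ρ ∧ (∀ x, ρ (τ L x) = x) ∧ ∀ x, τ L (ρ x) = x :=
    fun L hL => (hτ L hL).exists_inv
  choose! ρ hρ hρτ hτρ using hinv
  have hsub : ∀ L ∈ Λ, L ⊆ S := fun L hL x hx => hu ▸ ⟨L, hL, hx⟩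
  obtain ⟨C, hC, hCo, hCd, hCu, hCL⟩ := exists_grid
    (Λ := Λ ∪ Set.image2 (fun L L' => ρ L '' L') Λ Λ') (hfin.union (hfin.image2 _ hfin')) (by
      rintro L (hL | ⟨L, hL, L', hL', rfl⟩)
      · exact hΛ L hL
      · obtain ⟨k, hk⟩ := hΛ' L' hL'
        exact ⟨k, hk.image (hρ L hL)⟩)
  refine ⟨{c ∈ C | ∃ L ∈ Λ, c ⊆ L}, hC.subset fun c hc => hc.1, fun c hc => hCo c hc.1,
    hCd.subset fun c hc => hc.1, ?_, ?_⟩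
  · ext x
    constructor
    · rintro ⟨c, ⟨_, L, hL, hcL⟩, hx⟩
      exact hsub L hL (hcL hx)
    · intro hx
      rw [← hu] at hx
      obtain ⟨L, hL, hx⟩ := hx
      obtain ⟨c, hc, hxc⟩ : x ∈ ⋃₀ C := hCu ▸ Set.mem_univ x
      exact ⟨c, ⟨hc, L, hL, hCL c hc L (Or.inl hL) ⟨x, hxc, hx⟩⟩, hxc⟩
  · rintro c ⟨hc, L, hL, hcL⟩
    obtain ⟨k, hk⟩ := hCo c hc
    obtain ⟨x, hx⟩ := hk.nonempty
    have hxS : x ∈ S := hsub L hL (hcL hx)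
    obtain ⟨L', hL', hy⟩ : ((g ⟨x, hxS⟩ : S) : Fin N → ℤ) ∈ ⋃₀ Λ' := hu' ▸ (g ⟨x, hxS⟩ : S).2
    have hc' : c ⊆ ρ L '' L' := by
      refine hCL c hc _ (Or.inr ⟨L, hL, L', hL', rfl⟩) ⟨x, hx, _, hy, ?_⟩
      rw [hgτ L hL ⟨x, hxS⟩ (hcL hx), hρτ L hL]
    refine ⟨τ' L' ∘ τ L, (hτ' L' hL').comp (hτ L hL), fun z hz => ?_⟩
    have h1 := hgτ L hL z (hcL hz)
    have h2 : ((g z : S) : Fin N → ℤ) ∈ L' := by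
      obtain ⟨w, hw, hwz⟩ := hc' hz
      rw [h1, ← hwz, hτρ L hL]
      exact hw
    rw [Equiv.Perm.mul_apply, hfτ' L' hL' _ h2, h1]
    rfl

/-- A rank-`k` orthant has a parallel rank-`k` suborthant that does not cross any member of a
given finite family of orthants. -/
theorem exists_sub_box {Λ : Set (Set (Fin N → ℤ))} (hfin : Λ.Finite)
    (hΛ : ∀ L ∈ Λ, ∃ k, IsOrthant k L) (a : Fin N → ℤ) {s : Fin N → ℤ} (hs : IsSign s) :
    ∃ b ∈ box a s, ∀ L ∈ Λ, (box b s ∩ L).Nonempty → box b s ⊆ L := by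
  have hex : ∀ L ∈ Λ, ∃ a s, IsSign s ∧ L = box a s := fun L hL => by
    obtain ⟨k, hk⟩ := hΛ L hL
    obtain ⟨a, s, hs, _, h⟩ := hk.exists_box
    exact ⟨a, s, hs, h⟩
  choose! p t ht hbox using hex
  obtain ⟨M, hM0, hM⟩ : ∃ M : ℤ, 0 ≤ M ∧ ∀ L ∈ Λ, ∀ i, |p L i| ≤ M := by
    refine ⟨∑ L ∈ hfin.toFinset, ∑ i, |p L i|,
      Finset.sum_nonneg fun _ _ => Finset.sum_nonneg fun _ _ => abs_nonneg _, fun L hL i => ?_⟩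
    calc |p L i| ≤ ∑ i, |p L i| :=
          Finset.single_le_sum (f := fun i => |p L i|) (fun _ _ => abs_nonneg _) (Finset.mem_univ i)
      _ ≤ _ := Finset.single_le_sum (f := fun L => ∑ i, |p L i|)
          (fun _ _ => Finset.sum_nonneg fun _ _ => abs_nonneg _) (hfin.mem_toFinset.2 hL)
  refine ⟨fun i => a i + s i * (|a i| + M + 1), fun i => ?_, ?_⟩
  · have := abs_nonneg (a i)
    rcases hs i with h0 | h0 | h0 <;> simp [h0] <;> omega
  · rintro L hL ⟨y, hy, hyL⟩ x hx
    rw [hbox L hL] at hyL ⊢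
    intro i
    have h1 := hy i
    have h2 := hyL i
    have h3 := abs_le.1 (hM L hL i)
    have h4 := hx i
    have h5 := neg_abs_le (a i)
    have h6 := le_abs_self (a i)
    rcases hs i with h0 | h0 | h0 <;> rcases ht L hL i with h0' | h0' | h0' <;>
      simp [h0, h0'] at h1 h2 h4 ⊢ <;> omega

theorem box_subset {a b s : Fin N → ℤ} (hs : IsSign s) (hb : b ∈ box a s) :
    box b s ⊆ box a s := by
  intro x hx i
  have h1 := hx i
  have h2 := hb i
  rcases hs i with h0 | h0 | h0 <;> simp [h0] at h1 h2 ⊢ <;> omega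

theorem self_mem_box (a s : Fin N → ℤ) : a ∈ box a s := fun i => by simp

theorem add_mem_box {a b x s : Fin N → ℤ} (hx : x ∈ box a s) :
    b + (x - a) ∈ box b s := by
  intro i
  have h := hx i
  refine ⟨fun h0 => ?_, ?_⟩
  · simp [h.1 h0]
  · simpa using h.2

/-- An affine-orthogonal map fixing a parallel suborthant pointwise fixes the whole orthant. -/
theorem IsLatticeIsometry.eq_of_fix {τ : (Fin N → ℤ) → (Fin N → ℤ)} (h : IsLatticeIsometry τ)
    {a b s : Fin N → ℤ} (hb : b ∈ box a s) (hfix : ∀ x ∈ box b s, τ x = x) :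
    ∀ x ∈ box a s, τ x = x := by
  obtain ⟨A, _, c, hτ⟩ := h
  have hv : ∀ x ∈ box a s, A *ᵥ (x - a) = x - a := by
    intro x hx
    have h1 := hfix _ (add_mem_box (b := b) hx)
    have h2 := hfix _ (self_mem_box b s)
    rw [hτ, Matrix.mulVec_add, ← add_assoc, ← hτ, h2] at h1
    exact add_left_cancel h1
  intro x hx
  have h1 := hv x hx
  have h2 := hv b hb
  have h3 := hfix _ (self_mem_box b s)
  rw [hτ] at h3 ⊢
  rw [Matrix.mulVec_sub] at h1 h2
  have h4 : c + A *ᵥ x = (c + A *ᵥ b) + (A *ᵥ x - A *ᵥ a) - (A *ᵥ b - A *ᵥ a) := by abel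
  rw [h4, h1, h2, h3]
  abel

/-- The rank of a set is attained. -/
theorem rk_le_iff {T : Set (Fin N → ℤ)} {k : ℤ} (hk : -1 ≤ k) :
    rk T ≤ k ↔ ∀ (r : ℕ) L, IsOrthant r L → L ⊆ T → (r : ℤ) ≤ k := by
  have hbdd : BddAbove {r : ℤ | r = -1 ∨ ∃ k : ℕ, r = k ∧ ∃ L, IsOrthant k L ∧ L ⊆ T} := by
    refine ⟨N, ?_⟩
    rintro r (rfl | ⟨k, rfl, L, hL, _⟩)
    · omega
    · exact_mod_cast hL.le
  unfold rk
  rw [csSup_le_iff hbdd ⟨-1, Or.inl rfl⟩]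
  constructor
  · intro h r L hL hLT
    exact h r (Or.inr ⟨r, rfl, L, hL, hLT⟩)
  · rintro h r (rfl | ⟨k, rfl, L, hL, hLT⟩)
    · exact hk
    · exact h k L hL hLT

theorem neg_one_le_rk (T : Set (Fin N → ℤ)) : -1 ≤ rk T := by
  refine le_csSup ⟨N, ?_⟩ (Or.inl rfl)
  rintro r (rfl | ⟨k, rfl, L, hL, _⟩)
  · omega
  · exact_mod_cast hL.le

/-- On every orthant in `S`, a pei-permutation is isometric on some parallel suborthant. -/
theorem IsPei.exists_isometricOn {S : Set (Fin N → ℤ)} {g : Equiv.Perm S} (hg : IsPei g)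
    (a : Fin N → ℤ) {s : Fin N → ℤ} (hs : IsSign s) :
    ∃ b ∈ box a s, (∃ x ∈ box b s, x ∈ S) → box b s ⊆ S ∧ IsometricOn g (box b s) := by
  obtain ⟨Λ, hfin, hΛ, _, hu, hiso⟩ := hg
  obtain ⟨b, hb, hbL⟩ := exists_sub_box hfin hΛ a hs
  refine ⟨b, hb, ?_⟩
  rintro ⟨x, hx, hxS⟩
  rw [← hu] at hxS
  obtain ⟨L, hL, hxL⟩ := hxS
  have h := hbL L hL ⟨x, hx, hxL⟩
  exact ⟨fun y hy => hu ▸ ⟨L, hL, h hy⟩, (hiso L hL).mono h⟩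

/-- The rank of a pei-permutation is the maximal rank of an orthant on which it restricts to a
non-trivial isometric embedding. -/
theorem IsPei.rk_supp_le_iff {S : Set (Fin N → ℤ)} {g : Equiv.Perm S} (hg : IsPei g) {k : ℤ}
    (hk : -1 ≤ k) :
    rk (supp g) ≤ k ↔ ∀ (r : ℕ) L, IsOrthant r L → L ⊆ S → IsometricOn g L →
      k < r → ∀ x : S, (x : Fin N → ℤ) ∈ L → g x = x := by
  rw [rk_le_iff hk]
  constructor
  · intro h r L hL hLS hiso hr x hx
    by_contra hne
    have := h r L hL (Set.subset_sUnion_of_mem ⟨⟨r, hL⟩, hLS, hiso, x, hx, hne⟩)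
    omega
  · intro h r L hL hLsupp
    by_contra! hr
    obtain ⟨a, s, hs, hcard, rfl⟩ := hL.exists_box
    -- a suborthant all of whose translates by vectors of a finite set are fixed
    have key : ∀ E : Finset (Fin N → ℤ), ∃ b ∈ box a s, ∀ e ∈ E, ∀ x : S,
        (x : Fin N → ℤ) - e ∈ box b s → g x = x := by
      intro E
      induction E using Finset.induction_on with
      | empty => exact ⟨a, self_mem_box a s, by simp⟩
      | insert e E _ ih =>
        obtain ⟨b, hb, hbE⟩ := ih
        obtain ⟨c, hc, hcS⟩ := hg.exists_isometricOn (b + e) hs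
        have hc' : c - e ∈ box b s := by
          have := add_mem_box (b := b) hc
          convert this using 1
          abel
        refine ⟨c - e, box_subset hs hb hc', fun e' he' x hx => ?_⟩
        rcases Finset.mem_insert.1 he' with rfl | he'
        · have hx' : (x : Fin N → ℤ) ∈ box c s := by
            have := add_mem_box (b := c) hx
            convert this using 1
            abel
          obtain ⟨h1, h2⟩ := hcS ⟨x, hx', x.2⟩
          have h3 : IsOrthant r (box c s) := hcard ▸ isOrthant_box c hs
          exact h r _ h3 h1 h2 hr x hx'
        · exact hbE e' he' x (box_subset hs hc' hx)
    obtain ⟨b, hb, hbE⟩ := key (insert 0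
      ((Finset.univ.image fun i => Pi.single i (1 : ℤ)) ∪
        (Finset.univ.image fun i => Pi.single i (-1 : ℤ))))
    obtain ⟨L', ⟨⟨k', hk'⟩, hL'S, ⟨τ, ⟨A, hA, c, hτ⟩, hgτ⟩, y, hyL', hy⟩, hbL'⟩ := hLsupp hb
    obtain ⟨a', s', hs', _, rfl⟩ := hk'.exists_box
    have hbS : b ∈ S := hL'S hbL'
    have hb0 : c + A *ᵥ b = b := by
      rw [← hτ, ← hgτ ⟨b, hbS⟩ hbL', hbE 0 (by simp) ⟨b, hbS⟩ (by simpa using self_mem_box b s)]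
    have hstep : ∀ i, s' i ≠ 0 → A *ᵥ Pi.single i (1 : ℤ) = Pi.single i 1 := by
      intro i hi
      have hmem : b + Pi.single i (s' i) ∈ box a' s' := by
        intro j
        have h1 := hbL' j
        by_cases hj : j = i
        · subst hj
          rcases hs' j with h0 | h0 | h0 <;> simp [h0] at h1 hi ⊢ <;> omega
        · simpa [Pi.single_eq_of_ne hj] using h1
      have h1 := hbE (Pi.single i (s' i)) (by
        rcases hs' i with h0 | h0 | h0
        · exact absurd h0 hi
        · rw [h0]; simp
        · rw [h0]; simp) ⟨_, hL'S hmem⟩ (by simpa using self_mem_box b s)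
      have h2 := hgτ ⟨_, hL'S hmem⟩ hmem
      rw [h1, hτ, Matrix.mulVec_add, ← add_assoc, hb0] at h2
      have h3 : A *ᵥ Pi.single i (s' i) = Pi.single i (s' i) := (add_left_cancel h2).symm
      rcases hs' i with h0 | h0 | h0
      · exact absurd h0 hi
      · rwa [h0] at h3
      · rw [h0, Pi.single_neg, Matrix.mulVec_neg] at h3
        exact neg_injective h3
    apply hy
    apply Subtype.ext
    rw [hgτ y hyL', hτ]
    have h1 : A *ᵥ ((y : Fin N → ℤ) - b) = y - b := by
      have hsum : (y : Fin N → ℤ) - b = ∑ i, ((y : Fin N → ℤ) - b) i • Pi.single i (1 : ℤ) := by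
        ext j
        simp [Finset.sum_apply, Pi.single_apply]
      rw [hsum, Matrix.mulVec_sum]
      refine Finset.sum_congr rfl fun i _ => ?_
      rw [Matrix.mulVec_smul]
      by_cases hi : s' i = 0
      · have h2 := (hyL' i).1 hi
        have h3 := (hbL' i).1 hi
        simp [h2, h3]
      · rw [hstep i hi]
    rw [Matrix.mulVec_sub] at h1
    have h4 : c + A *ᵥ (y : Fin N → ℤ) =
        (c + A *ᵥ b) + (A *ᵥ (y : Fin N → ℤ) - A *ᵥ b) := by abel
    rw [h4, h1, hb0]
    abel

theorem rk_supp_one (S : Set (Fin N → ℤ)) : rk (supp (1 : Equiv.Perm S)) = -1 := by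
  refine le_antisymm ((rk_le_iff le_rfl).2 fun r L hL hLs => ?_) (neg_one_le_rk _)
  obtain ⟨x, hx⟩ := hL.nonempty
  obtain ⟨_, ⟨_, _, _, y, _, hy⟩, _⟩ := hLs hx
  exact absurd rfl hy

theorem IsPei.rk_supp_mul_le {S : Set (Fin N → ℤ)} {f g : Equiv.Perm S} (hf : IsPei f)
    (hg : IsPei g) {k : ℤ} (hk : -1 ≤ k) (hfk : rk (supp f) ≤ k) (hgk : rk (supp g) ≤ k) :
    rk (supp (f * g)) ≤ k := by
  rw [hf.rk_supp_le_iff hk] at hfk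
  rw [hg.rk_supp_le_iff hk] at hgk
  rw [(hf.mul hg).rk_supp_le_iff hk]
  rintro r L hL hLS ⟨τ, hτ, hfg⟩ hr x hx
  obtain ⟨a, s, hs, hcard, rfl⟩ := hL.exists_box
  obtain ⟨b, hb, hbS⟩ := hg.exists_isometricOn a hs
  obtain ⟨h1, h2⟩ := hbS ⟨b, self_mem_box b s, hLS hb⟩
  obtain ⟨c, hc, hcS⟩ := hf.exists_isometricOn b hs
  obtain ⟨h3, h4⟩ := hcS ⟨c, self_mem_box c s, h1 hc⟩
  have hcb := box_subset hs hc
  have hba := box_subset hs hb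
  have hfix : ∀ y ∈ box c s, τ y = y := by
    intro y hy
    have h5 := hgk r _ (hcard ▸ isOrthant_box b hs) h1 h2 hr ⟨y, h3 hy⟩ (hcb hy)
    have h6 := hfk r _ (hcard ▸ isOrthant_box c hs) h3 h4 hr ⟨y, h3 hy⟩ hy
    rw [← hfg ⟨y, h3 hy⟩ (hba (hcb hy)), Equiv.Perm.mul_apply, h5, h6]
  apply Subtype.ext
  rw [hfg x hx]
  exact hτ.eq_of_fix (hba hc) hfix _ hx

theorem IsPei.rk_supp_inv_le {S : Set (Fin N → ℤ)} {g : Equiv.Perm S} (hg : IsPei g) {k : ℤ}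
    (hk : -1 ≤ k) (hgk : rk (supp g) ≤ k) : rk (supp g⁻¹) ≤ k := by
  rw [hg.rk_supp_le_iff hk] at hgk
  rw [hg.inv.rk_supp_le_iff hk]
  rintro r L hL hLS ⟨τ, hτ, hgτ⟩ hr x hx
  obtain ⟨ρ, hρ, h1, _⟩ := hτ.exists_inv
  have hsub : τ '' L ⊆ S := by
    rintro _ ⟨y, hy, rfl⟩
    rw [← hgτ ⟨y, hLS hy⟩ hy]
    exact (g⁻¹ _).2
  have hiso : IsometricOn g (τ '' L) := by
    refine ⟨ρ, hρ, ?_⟩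
    rintro ⟨_, hz⟩ ⟨y, hy, rfl⟩
    have h2 : (⟨τ y, hz⟩ : S) = g⁻¹ ⟨y, hLS hy⟩ := Subtype.ext (hgτ ⟨y, hLS hy⟩ hy).symm
    rw [h1, h2]
    simp
  have h3 := hgk r _ (hL.image hτ) hsub hiso hr (g⁻¹ x) ⟨x, hx, (hgτ x hx).symm⟩
  rw [← h3]
  simp

end Aux

/-! ### The groups -/

/-- The group `pei(S)` of all piecewise Euclidean isometric permutations of an orthohedral
set `S`. -/
def pei {N : ℕ} (S : Set (Fin N → ℤ)) (hS : IsOrthohedral S) : Subgroup (Equiv.Perm S) where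
  carrier := {g | IsPei g}
  one_mem' := isPei_one hS
  mul_mem' hf hg := hf.mul hg
  inv_mem' hg := hg.inv

/-- The rank of an element of `pei(S)` is the rank of its support. -/
noncomputable def rkElt {N : ℕ} {S : Set (Fin N → ℤ)} {hS : IsOrthohedral S} (g : pei S hS) : ℤ :=
  rk (supp (g : Equiv.Perm S))

/-- The rank of a subgroup of `pei(S)`: the maximal rank of its elements. -/
noncomputable def rkSubgroup {N : ℕ} {S : Set (Fin N → ℤ)} {hS : IsOrthohedral S}
    (H : Subgroup (pei S hS)) : ℤ :=
  sSup {r : ℤ | ∃ g ∈ H, r = rkElt g}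

/-- The rank subgroup `G_k` of `G = pei(S)`: all elements of rank at most `k`. For `k ≤ -1` it is
the trivial group. -/
noncomputable def rankSubgroup {N : ℕ} (S : Set (Fin N → ℤ)) (hS : IsOrthohedral S) (k : ℤ) :
    Subgroup (pei S hS) where
  carrier := {g | rkElt g ≤ max k (-1)}
  one_mem' := (rk_supp_one S).le.trans (le_max_right _ _)
  mul_mem' {f g} hf hg := IsPei.rk_supp_mul_le f.2 g.2 (le_max_right _ _) hf hg
  inv_mem' {g} hg := IsPei.rk_supp_inv_le g.2 (le_max_right _ _) hg

/-- The subgroup `alt G_k` of the even elements of `G_k`: the products of an even number of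
orthant-transpositions of rank `k`. There are none of rank `k < 0`, so that `alt G_k = 1` then. -/
noncomputable def altRankSubgroup {N : ℕ} (S : Set (Fin N → ℤ)) (hS : IsOrthohedral S) (k : ℤ) :
    Subgroup (pei S hS) where
  carrier := {g | g ∈ rankSubgroup S hS k ∧ ∃ l : List (pei S hS), Even l.length ∧
    (∀ t ∈ l, ∃ r : ℕ, (r : ℤ) = k ∧ IsOrthantTransposition r (t : Equiv.Perm S)) ∧ l.prod = g}
  one_mem' := ⟨one_mem _, [], by simp, by simp, by simp⟩
  mul_mem' := by
    rintro _ _ ⟨h, l, hl, hlt, rfl⟩ ⟨h', l', hl', hlt', rfl⟩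
    refine ⟨mul_mem h h', l ++ l', by simpa using hl.add hl', fun t ht => ?_, by simp⟩
    rcases List.mem_append.1 ht with ht | ht
    · exact hlt t ht
    · exact hlt' t ht
  inv_mem' := by
    rintro _ ⟨h, l, hl, hlt, rfl⟩
    refine ⟨inv_mem h, l.reverse, by simpa using hl, fun t ht => hlt t (by simpa using ht), ?_⟩
    have hinv : ∀ t ∈ l, t⁻¹ = t := by
      intro t ht
      obtain ⟨r, _, L, L', _, _, _, _, _, _, _, _, h1, h2⟩ := hlt t ht
      refine inv_eq_of_mul_eq_one_left (Subtype.ext (Equiv.ext fun x => ?_))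
      by_cases hx : (x : Fin N → ℤ) ∈ L ∪ L'
      · exact h1 x hx
      · have h3 := h2 x hx
        show (t : Equiv.Perm S) ((t : Equiv.Perm S) x) = x
        rw [h3, h3]
    rw [List.prod_inv_reverse, List.map_congr_left hinv, List.map_id']

end Pei

/-! The upper bound is immediate, since every element of `H` has rank at most the rank of `H`. The
lower bound rests on the classical argument that a nontrivial normal subgroup of an infinite
finitary symmetric group contains all even permutations. Here embedded rank-`m` orthants, with rank
`H` equal to `m + 1`, play the role of points.

Fix a standard face of rank `m`. The group permutes `S`, hence acts on maps from the face to `S`; an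
orthant-transposition is a swap of two isometric embeddings with disjoint ranges. Two facts make
such embeddings behave like points of an infinite set: any two disjoint ones are swapped by a group
element (`exists_swap_pei`), and finitely many always leave room for another
(`exists_apart_embedding`). The second fact holds because `S` contains an orthant of rank `m + 1`,
which finitely many orthants of rank `m` cannot cover.

An element of `H` of rank `m + 1` is isometric and nontrivial on some orthant of that rank. Inside
it there are two disjoint rank-`m` orthants which the element moves off their union
(`exists_slices`). Commutators then give a 3-cycle of embeddings in `H` (`exists_isThreeCycle_mem`),
conjugation gives all 3-cycles (`IsThreeCycle.mem`), and 3-cycles generate every product of two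
swaps (`IsSwap.mul_mem_of_normal`). -/

namespace Pei

/-! ### Exchanging disjoint maps

A group acting on `α` acts on the maps `F → α`. We look at the elements that exchange two maps
with disjoint ranges. -/

section Swap

variable {G α F : Type*} [Group G] [MulAction G α]

/-- Two maps with disjoint ranges. -/
def Apart (φ ψ : F → α) : Prop := ∀ f f', φ f ≠ ψ f'

/-- The group element `t` exchanges the maps `φ` and `ψ` and fixes all points outside their
ranges. -/
def IsSwap (φ ψ : F → α) (t : G) : Prop :=
  t • φ = ψ ∧ t • ψ = φ ∧ ∀ x, (∀ f, φ f ≠ x) → (∀ f, ψ f ≠ x) → t • x = x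

theorem Apart.symm {φ ψ : F → α} (h : Apart φ ψ) : Apart ψ φ := fun f f' e => h f' f e.symm

theorem IsSwap.symm {φ ψ : F → α} {t : G} (h : IsSwap φ ψ t) : IsSwap ψ φ t :=
  ⟨h.2.1, h.1, fun x h1 h2 => h.2.2 x h2 h1⟩

theorem IsSwap.conj {φ ψ : F → α} {t : G} (h : IsSwap φ ψ t) (g : G) :
    IsSwap (g • φ) (g • ψ) (g * t * g⁻¹) := by
  refine ⟨?_, ?_, fun x h1 h2 => ?_⟩
  · rw [smul_smul, inv_mul_cancel_right, mul_smul, h.1]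
  · rw [smul_smul, inv_mul_cancel_right, mul_smul, h.2.1]
  · rw [mul_smul, mul_smul, h.2.2, smul_inv_smul]
    · rintro f hf
      exact h1 f (by simp [hf])
    · rintro f hf
      exact h2 f (by simp [hf])

theorem IsSwap.smul_eq {φ ψ χ : F → α} {t : G} (h : IsSwap φ ψ t) (h1 : Apart φ χ)
    (h2 : Apart ψ χ) : t • χ = χ :=
  funext fun f => h.2.2 _ (fun f' => h1 f' f) (fun f' => h2 f' f)

/-- The product of two swaps sharing one map is a 3-cycle of maps. -/
def IsThreeCycle (φ : Fin 3 → F → α) (c : G) : Prop :=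
  ∃ t u : G, IsSwap (φ 0) (φ 1) t ∧ IsSwap (φ 1) (φ 2) u ∧ t * u = c

theorem IsThreeCycle.conj {φ : Fin 3 → F → α} {c : G} (hc : IsThreeCycle φ c) (g : G) :
    IsThreeCycle (fun i => g • φ i) (g * c * g⁻¹) := by
  obtain ⟨t, u, ht, hu, rfl⟩ := hc
  exact ⟨_, _, ht.conj g, hu.conj g, by group⟩

/-- A triple of admissible maps with pairwise disjoint ranges. -/
def IsTriple (V : Set (F → α)) (φ : Fin 3 → F → α) : Prop :=
  (∀ i, φ i ∈ V) ∧ Pairwise fun i j => Apart (φ i) (φ j)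

theorem isTriple_iff {V : Set (F → α)} {φ : Fin 3 → F → α} :
    IsTriple V φ ↔ (∀ i, φ i ∈ V) ∧ Apart (φ 0) (φ 1) ∧ Apart (φ 0) (φ 2) ∧
      Apart (φ 1) (φ 2) := by
  refine and_congr_right fun _ => ⟨fun h => ⟨h (by decide), h (by decide), h (by decide)⟩, ?_⟩
  rintro ⟨h01, h02, h12⟩ i j hij
  fin_cases i <;> fin_cases j <;>
    first | exact absurd rfl hij | exact h01 | exact h02 | exact h12 | exact h01.symm |
      exact h02.symm | exact h12.symm

/-- Every finite set of admissible maps leaves room for a disjoint triple. -/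
theorem exists_triple_apart {V : Set (F → α)}
    (hfresh : ∀ Φ ⊆ V, Φ.Finite → ∃ χ ∈ V, ∀ φ ∈ Φ, Apart φ χ) {Φ : Set (F → α)} (hΦ : Φ ⊆ V)
    (hfin : Φ.Finite) : ∃ χ, IsTriple V χ ∧ ∀ φ ∈ Φ, ∀ i, Apart φ (χ i) := by
  obtain ⟨χ₀, h₀, hχ₀⟩ := hfresh Φ hΦ hfin
  obtain ⟨χ₁, h₁, hχ₁⟩ := hfresh (insert χ₀ Φ) (Set.insert_subset h₀ hΦ) (hfin.insert _)
  obtain ⟨χ₂, h₂, hχ₂⟩ := hfresh (insert χ₁ (insert χ₀ Φ))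
    (Set.insert_subset h₁ (Set.insert_subset h₀ hΦ)) ((hfin.insert _).insert _)
  refine ⟨![χ₀, χ₁, χ₂], isTriple_iff.2 ⟨fun i => ?_, hχ₁ _ (Or.inl rfl),
    hχ₂ _ (Or.inr (Or.inl rfl)), hχ₂ _ (Or.inl rfl)⟩, fun φ hφ i => ?_⟩
  · fin_cases i
    exacts [h₀, h₁, h₂]
  · fin_cases i
    exacts [hχ₀ _ hφ, hχ₁ _ (Or.inr hφ), hχ₂ _ (Or.inr (Or.inr hφ))]

variable [FaithfulSMul G α]

/-- The definition prescribes the action of a swap on every point, and the action is faithful. The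
relations used later (order two, commutation, the braid relation) all come from recognising two
elements as swaps of the same pair. -/
theorem IsSwap.unique {φ ψ : F → α} {t u : G} (ht : IsSwap φ ψ t) (hu : IsSwap φ ψ u) :
    t = u := by
  refine FaithfulSMul.eq_of_smul_eq_smul (α := α) fun x => ?_
  by_cases h1 : ∃ f, φ f = x
  · obtain ⟨f, rfl⟩ := h1
    exact (congrFun ht.1 f).trans (congrFun hu.1 f).symm
  by_cases h2 : ∃ f, ψ f = x
  · obtain ⟨f, rfl⟩ := h2
    exact (congrFun ht.2.1 f).trans (congrFun hu.2.1 f).symm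
  push Not at h1 h2
  rw [ht.2.2 x h1 h2, hu.2.2 x h1 h2]

theorem IsSwap.mul_self {φ ψ : F → α} {t : G} (h : IsSwap φ ψ t) : t * t = 1 := by
  rw [mul_eq_one_iff_eq_inv]
  have h3 : IsSwap φ ψ t⁻¹ := by
    refine ⟨?_, ?_, fun x h4 h5 => ?_⟩
    · rw [inv_smul_eq_iff, h.2.1]
    · rw [inv_smul_eq_iff, h.1]
    · rw [inv_smul_eq_iff, h.2.2 x h4 h5]
  exact h.unique h3

theorem IsSwap.inv_eq {φ ψ : F → α} {t : G} (h : IsSwap φ ψ t) : t⁻¹ = t :=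
  inv_eq_of_mul_eq_one_left h.mul_self

theorem IsSwap.commute {φ ψ φ' ψ' : F → α} {t u : G} (ht : IsSwap φ ψ t) (hu : IsSwap φ' ψ' u)
    (h1 : Apart φ φ') (h2 : Apart φ ψ') (h3 : Apart ψ φ') (h4 : Apart ψ ψ') : Commute t u := by
  have h := hu.conj t
  rw [ht.smul_eq h1 h3, ht.smul_eq h2 h4] at h
  exact mul_inv_eq_iff_eq_mul.1 (h.unique hu)

theorem IsThreeCycle.unique {φ : Fin 3 → F → α} {c d : G} (hc : IsThreeCycle φ c)
    (hd : IsThreeCycle φ d) : c = d := by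
  obtain ⟨t, u, ht, hu, rfl⟩ := hc
  obtain ⟨t', u', ht', hu', rfl⟩ := hd
  rw [ht.unique ht', hu.unique hu']

/-- The product of the three swaps `φ i ↔ ψ i` carries one triple to the other, because each swap
fixes the maps with the other indices; so it conjugates `c` to `d`. -/
theorem IsThreeCycle.mem_of_apart {V : Set (F → α)}
    (hswap : ∀ φ ∈ V, ∀ ψ ∈ V, Apart φ ψ → ∃ t : G, IsSwap φ ψ t) {H : Subgroup G}
    (hH : H.Normal) {φ ψ : Fin 3 → F → α} (hφ : IsTriple V φ) (hψ : IsTriple V ψ)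
    (hφψ : ∀ i j, Apart (φ i) (ψ j)) {c d : G} (hc : IsThreeCycle φ c) (hd : IsThreeCycle ψ d)
    (hcH : c ∈ H) : d ∈ H := by
  have hex : ∀ i, ∃ t : G, IsSwap (φ i) (ψ i) t := fun i =>
    hswap _ (hφ.1 i) _ (hψ.1 i) (hφψ i i)
  choose t ht using hex
  have hfix : ∀ i j, j ≠ i → t i • φ j = φ j := fun i j hij =>
    (ht i).smul_eq (hφ.2 hij.symm) (hφψ j i).symm
  have hfix' : ∀ i j, j ≠ i → t i • ψ j = ψ j := fun i j hij =>
    (ht i).smul_eq (hφψ i j) (hψ.2 hij.symm)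
  have h := hc.conj (t 0 * t 1 * t 2)
  have hval : (fun i => (t 0 * t 1 * t 2) • φ i) = ψ := by
    funext i
    rw [mul_smul, mul_smul]
    fin_cases i
    · show t 0 • t 1 • t 2 • φ 0 = ψ 0
      rw [hfix 2 0 (by decide), hfix 1 0 (by decide), (ht 0).1]
    · show t 0 • t 1 • t 2 • φ 1 = ψ 1
      rw [hfix 2 1 (by decide), (ht 1).1, hfix' 0 1 (by decide)]
    · show t 0 • t 1 • t 2 • φ 2 = ψ 2
      rw [(ht 2).1, hfix' 1 2 (by decide), hfix' 0 2 (by decide)]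
  rw [hval] at h
  rw [hd.unique h]
  exact hH.conj_mem c hcH _

/-- A normal subgroup containing one 3-cycle of admissible maps contains all of them. -/
theorem IsThreeCycle.mem {V : Set (F → α)}
    (hswap : ∀ φ ∈ V, ∀ ψ ∈ V, Apart φ ψ → ∃ t : G, IsSwap φ ψ t)
    (hfresh : ∀ Φ ⊆ V, Φ.Finite → ∃ χ ∈ V, ∀ φ ∈ Φ, Apart φ χ) {H : Subgroup G}
    (hH : H.Normal) {φ ψ : Fin 3 → F → α} (hφ : IsTriple V φ) (hψ : IsTriple V ψ)
    {c d : G} (hc : IsThreeCycle φ c) (hd : IsThreeCycle ψ d) (hcH : c ∈ H) : d ∈ H := by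
  -- The two triples may overlap, so the conjugation passes through a third one disjoint from both.
  obtain ⟨χ, hχ, hχa⟩ := exists_triple_apart hfresh (Φ := Set.range φ ∪ Set.range ψ)
    (Set.union_subset (Set.range_subset_iff.2 hφ.1) (Set.range_subset_iff.2 hψ.1))
    ((Set.finite_range φ).union (Set.finite_range ψ))
  obtain ⟨t, ht⟩ := hswap _ (hχ.1 0) _ (hχ.1 1) (hχ.2 (by decide))
  obtain ⟨u, hu⟩ := hswap _ (hχ.1 1) _ (hχ.1 2) (hχ.2 (by decide))
  have he : IsThreeCycle χ (t * u) := ⟨t, u, ht, hu, rfl⟩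
  have h1 := IsThreeCycle.mem_of_apart hswap hH hφ hχ
    (fun i j => hχa _ (Or.inl ⟨i, rfl⟩) j) hc he hcH
  exact IsThreeCycle.mem_of_apart hswap hH hχ hψ
    (fun i j => (hχa _ (Or.inr ⟨j, rfl⟩) i).symm) he hd h1

/-- A normal subgroup that moves two disjoint admissible maps off themselves contains a
3-cycle. -/
theorem exists_isThreeCycle_mem {V : Set (F → α)}
    (hswap : ∀ φ ∈ V, ∀ ψ ∈ V, Apart φ ψ → ∃ t : G, IsSwap φ ψ t)
    (hfresh : ∀ Φ ⊆ V, Φ.Finite → ∃ χ ∈ V, ∀ φ ∈ Φ, Apart φ χ) {H : Subgroup G}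
    (hH : H.Normal) {g : G} (hg : g ∈ H) {φ ψ : F → α} (hφ : φ ∈ V) (hψ : ψ ∈ V)
    (hgφ : g • φ ∈ V) (hgψ : g • ψ ∈ V) (h : Apart φ ψ) (hφφ : Apart (g • φ) φ)
    (hφψ : Apart (g • φ) ψ) (hψφ : Apart (g • ψ) φ) (hψψ : Apart (g • ψ) ψ) :
    ∃ χ, IsTriple V χ ∧ ∃ c ∈ H, IsThreeCycle χ c := by
  -- Avoiding the two translates as well makes the swap `u` of `ψ` and `χ` commute with the
  -- conjugate of `t` by `g`.
  obtain ⟨χ, hχ, hχa⟩ := hfresh {φ, ψ, g • φ, g • ψ}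
    (by rintro _ (rfl | rfl | rfl | rfl) <;> assumption) (Set.toFinite _)
  have h1 := hχa φ (by simp)
  have h2 := hχa ψ (by simp)
  have h3 := hχa (g • φ) (by simp)
  have h4 := hχa (g • ψ) (by simp)
  obtain ⟨t, ht⟩ := hswap φ hφ ψ hψ h
  obtain ⟨u, hu⟩ := hswap ψ hψ χ hχ h2
  refine ⟨![χ, ψ, φ], isTriple_iff.2 ⟨fun i => ?_, h2.symm, h1.symm, h.symm⟩, u * t, ?_,
    u, t, hu.symm, ht.symm, rfl⟩
  · fin_cases i
    exacts [hχ, hψ, hφ]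
  have ht' := ht.conj g
  set t' := g * t * g⁻¹ with ht'_def
  have hc1 : Commute t' t := ht'.commute ht hφφ hφψ hψφ hψψ
  have hc2 : Commute t' u := ht'.commute hu hφψ h3 hψψ h4
  have hmem : t' * t ∈ H := by
    -- Since `t` is an involution, `t' * t` is the commutator of `g` and `t`.
    have : t' * t = g * (t * g⁻¹ * t⁻¹) := by rw [ht'_def, ht.inv_eq]; group
    rw [this]
    exact mul_mem hg (hH.conj_mem _ (inv_mem hg) t)
  have hmem2 : (t' * t)⁻¹ * (u * (t' * t) * u⁻¹) ∈ H :=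
    mul_mem (inv_mem hmem) (hH.conj_mem _ hmem u)
  -- In this second commutator `t'` cancels, since it commutes with both `t` and `u`; only the
  -- square of `t * u` survives.
  have heq : (t' * t)⁻¹ * (u * (t' * t) * u⁻¹) = t * u * (t * u) := by
    have e1 : u * (t' * t) = t' * (u * t) := by rw [← mul_assoc, ← hc2.eq, mul_assoc]
    rw [e1, mul_inv_rev, ht.inv_eq, hu.inv_eq]
    group
  -- Conjugating `u` by `t` and `t` by `u` both yield the swap of `φ` and `χ`. This is the braid
  -- relation, so `t * u` has cube one and its square is its inverse `u * t`.
  have hcube : t * u * (t * u) = u * t := by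
    have e1 : IsSwap φ χ (t * u * t⁻¹) := by
      have := hu.conj t
      rwa [ht.2.1, ht.smul_eq h1 h2] at this
    have e2 : IsSwap φ χ (u * t * u⁻¹) := by
      have := ht.conj u
      rwa [hu.1, hu.smul_eq h.symm h1.symm] at this
    have e3 := e1.unique e2
    rw [ht.inv_eq, hu.inv_eq] at e3
    rw [← mul_assoc, e3, mul_assoc, hu.mul_self, mul_one]
  rw [← hcube, ← heq]
  exact hmem2

/-- A normal subgroup that moves two disjoint admissible maps off themselves contains all products
of two swaps. -/
theorem IsSwap.mul_mem_of_normal {V : Set (F → α)}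
    (hswap : ∀ φ ∈ V, ∀ ψ ∈ V, Apart φ ψ → ∃ t : G, IsSwap φ ψ t)
    (hfresh : ∀ Φ ⊆ V, Φ.Finite → ∃ χ ∈ V, ∀ φ ∈ Φ, Apart φ χ) {H : Subgroup G}
    (hH : H.Normal) {g : G} (hg : g ∈ H) {φ ψ : F → α} (hφ : φ ∈ V) (hψ : ψ ∈ V)
    (hgφ : g • φ ∈ V) (hgψ : g • ψ ∈ V) (h : Apart φ ψ) (hφφ : Apart (g • φ) φ)
    (hφψ : Apart (g • φ) ψ) (hψφ : Apart (g • ψ) φ) (hψψ : Apart (g • ψ) ψ)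
    {φ₁ φ₂ ψ₁ ψ₂ : F → α} (hφ₁ : φ₁ ∈ V) (hφ₂ : φ₂ ∈ V) (hψ₁ : ψ₁ ∈ V) (hψ₂ : ψ₂ ∈ V)
    (hφa : Apart φ₁ φ₂) (hψa : Apart ψ₁ ψ₂) {t u : G} (ht : IsSwap φ₁ φ₂ t)
    (hu : IsSwap ψ₁ ψ₂ u) : t * u ∈ H := by
  obtain ⟨ξ, hξ, c, hcH, hc⟩ := exists_isThreeCycle_mem hswap hfresh hH hg hφ hψ hgφ hgψ h
    hφφ hφψ hψφ hψψ
  -- The swaps `t` and `u` may overlap arbitrarily, so each is compared with an auxiliary swap `v`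
  -- disjoint from both.
  obtain ⟨χ, hχ, hχa⟩ := exists_triple_apart hfresh (Φ := {φ₁, φ₂, ψ₁, ψ₂})
    (by rintro _ (rfl | rfl | rfl | rfl) <;> assumption) (Set.toFinite _)
  obtain ⟨v, hv⟩ := hswap _ (hχ.1 0) _ (hχ.1 1) (hχ.2 (by decide))
  have key : ∀ {θ₁ θ₂ : F → α} {w : G}, θ₁ ∈ V → θ₂ ∈ V → Apart θ₁ θ₂ → IsSwap θ₁ θ₂ w →
      (∀ i, Apart θ₁ (χ i)) → (∀ i, Apart θ₂ (χ i)) → w * v ∈ H := by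
    intro θ₁ θ₂ w h₁ h₂ ha hw ha₁ ha₂
    -- With `z` the swap of `θ₂` and `χ 0`, one has `w * v = (w * z) * (z * v)`, a product of two
    -- 3-cycles.
    obtain ⟨z, hz⟩ := hswap _ h₂ _ (hχ.1 0) (ha₂ 0)
    have m1 : w * z ∈ H := by
      refine IsThreeCycle.mem hswap hfresh hH hξ (ψ := ![θ₁, θ₂, χ 0])
        (isTriple_iff.2 ⟨fun i => ?_, ha, ha₁ 0, ha₂ 0⟩) hc ⟨w, z, hw, hz, rfl⟩ hcH
      fin_cases i
      exacts [h₁, h₂, hχ.1 0]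
    have m2 : z * v ∈ H := by
      refine IsThreeCycle.mem hswap hfresh hH hξ (ψ := ![θ₂, χ 0, χ 1])
        (isTriple_iff.2 ⟨fun i => ?_, ha₂ 0, ha₂ 1, hχ.2 (by decide)⟩) hc
        ⟨z, v, hz, hv, rfl⟩ hcH
      fin_cases i
      exacts [h₂, hχ.1 0, hχ.1 1]
    have := mul_mem m1 m2
    rwa [mul_assoc, ← mul_assoc z, hz.mul_self, one_mul] at this
  have k1 := key hφ₁ hφ₂ hφa ht (hχa _ (by simp)) (hχa _ (by simp))
  have k2 := key hψ₁ hψ₂ hψa hu (hχa _ (by simp)) (hχa _ (by simp))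
  have := mul_mem k1 (inv_mem k2)
  rwa [mul_inv_rev, hu.inv_eq, mul_assoc, mul_inv_cancel_left] at this

end Swap

open Matrix

/-! ### Geometry of orthants: standard faces, rank, slices of corank one. -/

section Orthants

variable {N : ℕ}

theorem IsLatticeIsometry.injective {τ : (Fin N → ℤ) → (Fin N → ℤ)} (h : IsLatticeIsometry τ) :
    Function.Injective τ := by
  obtain ⟨ρ, _, h1, _⟩ := h.exists_inv
  exact Function.LeftInverse.injective h1

theorem isLatticeIsometry_comp_perm (e : Equiv.Perm (Fin N)) :
    IsLatticeIsometry fun x : Fin N → ℤ => x ∘ e := by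
  refine ⟨e.permMatrix ℤ, ?_, 0, fun x => ?_⟩
  · rw [Matrix.mem_orthogonalGroup_iff]
    rw [Matrix.transpose_permMatrix, ← Matrix.permMatrix_mul, inv_mul_cancel,
      Matrix.permMatrix_one]
  · rw [zero_add]
    exact (Matrix.permMatrix_mulVec e).symm

/-- An orthant is isometric to every standard face of the same rank. -/
theorem IsOrthant.exists_image_face {Y : Finset (Fin N)} {L : Set (Fin N → ℤ)}
    (hL : IsOrthant Y.card L) : ∃ τ, IsLatticeIsometry τ ∧ L = τ '' face Y := by
  obtain ⟨τ, hτ, Z, hZ, rfl⟩ := hL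
  let e : Equiv.Perm (Fin N) := (Finset.equivOfCardEq hZ).extendSubtype
  have he : ∀ i, e i ∈ Y ↔ i ∈ Z := fun i => by
    by_cases hi : i ∈ Z
    · exact iff_of_true (Equiv.extendSubtype_mem _ i hi) hi
    · exact iff_of_false (Equiv.extendSubtype_not_mem _ i hi) hi
  refine ⟨τ ∘ fun x => x ∘ e, hτ.comp (isLatticeIsometry_comp_perm e), ?_⟩
  rw [Set.image_comp]
  congr 1
  ext x
  constructor
  · intro hx
    refine ⟨x ∘ e.symm, fun i => ⟨(hx _).1, fun hi => (hx _).2 ?_⟩, by ext; simp⟩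
    rwa [← he, e.apply_symm_apply]
  · rintro ⟨y, hy, rfl⟩ i
    exact ⟨(hy _).1, fun hi => (hy _).2 (by rwa [he])⟩

/-- Inclusion of orthants is monotone in the rank. -/
theorem IsOrthant.rank_le {k l : ℕ} {L M : Set (Fin N → ℤ)} (hL : IsOrthant k L)
    (hM : IsOrthant l M) (h : L ⊆ M) : k ≤ l := by
  obtain ⟨a, s, hs, rfl, rfl⟩ := hL.exists_box
  obtain ⟨b, t, ht, rfl, rfl⟩ := hM.exists_box
  refine Finset.card_le_card fun i hi => ?_
  simp only [Finset.mem_filter, Finset.mem_univ, true_and] at hi ⊢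
  intro h0
  have h1 := (h (self_mem_box a s) i).1 h0
  have h2 : a + Pi.single i (s i) ∈ box a s := by
    intro j
    by_cases hj : j = i
    · subst hj
      simp [hi, mul_self_nonneg]
    · simp [hj]
  have h3 := (h h2 i).1 h0
  simp [h1, hi] at h3

/-- The part of the orthant `box a s` where the coordinate `j` is `p` steps away from the base and
all other coordinates are at least `K` steps away. -/
def slice (a s : Fin N → ℤ) (j : Fin N) (K p : ℤ) : Set (Fin N → ℤ) :=
  box (fun l => a l + s l * if l = j then p else K) (Function.update s j 0)

theorem mem_slice_self {a s : Fin N → ℤ} {j : Fin N} {K p : ℤ} {y : Fin N → ℤ}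
    (hy : y ∈ slice a s j K p) : y j = a j + s j * p := by
  simpa using (hy j).1

theorem mem_slice_of_ne {a s : Fin N → ℤ} {j : Fin N} {K p : ℤ} {y : Fin N → ℤ}
    (hy : y ∈ slice a s j K p) {l : Fin N} (hl : l ≠ j) :
    (s l = 0 → y l = a l) ∧ (s l = 1 → a l + K ≤ y l) ∧ (s l = -1 → y l ≤ a l - K) := by
  have h := hy l
  simp only [hl, if_false, Function.update_of_ne hl] at h
  refine ⟨fun h0 => ?_, fun h0 => ?_, fun h0 => ?_⟩ <;> simp [h0] at h <;> linarith

theorem slice_subset {a s : Fin N → ℤ} (hs : IsSign s) (j : Fin N) {K p : ℤ} (hK : 0 ≤ K)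
    (hp : 0 ≤ p) : slice a s j K p ⊆ box a s := by
  intro y hy l
  by_cases hl : l = j
  · subst hl
    rw [mem_slice_self hy]
    rcases hs l with h0 | h0 | h0 <;> simp [h0, hp]
  · have h := mem_slice_of_ne hy hl
    rcases hs l with h0 | h0 | h0 <;> simp [h0] at h ⊢ <;> omega

theorem isOrthant_slice {a s : Fin N → ℤ} (hs : IsSign s) {j : Fin N} (hj : s j ≠ 0) {m : ℕ}
    (hm : (Finset.univ.filter fun i => s i ≠ 0).card = m + 1) (K p : ℤ) :
    IsOrthant m (slice a s j K p) := by
  have hs' : IsSign (Function.update s j 0) := by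
    intro l
    by_cases hl : l = j
    · subst hl
      simp
    · simpa [hl] using hs l
  have h := isOrthant_box (fun l => a l + s l * if l = j then p else K) hs'
  have he : (Finset.univ.filter fun i => Function.update s j 0 i ≠ 0) =
      (Finset.univ.filter fun i => s i ≠ 0).erase j := by
    ext l
    by_cases hl : l = j
    · subst hl
      simp
    · simp [hl]
  rw [he, Finset.card_erase_of_mem (by simpa using hj), hm, Nat.add_sub_cancel] at h
  exact h

/-- A non-trivial isometric embedding of an orthant moves two disjoint suborthants of corank one
off their union. -/
theorem exists_slices {a s : Fin N → ℤ} (hs : IsSign s) {m : ℕ}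
    (hm : (Finset.univ.filter fun i => s i ≠ 0).card = m + 1)
    {τ : (Fin N → ℤ) → (Fin N → ℤ)} (hτ : IsLatticeIsometry τ) {x : Fin N → ℤ}
    (hx : x ∈ box a s) (hne : τ x ≠ x) :
    ∃ M M' : Set (Fin N → ℤ), IsOrthant m M ∧ IsOrthant m M' ∧ M ⊆ box a s ∧ M' ⊆ box a s ∧
      Disjoint M M' ∧ ∀ y ∈ M ∪ M', τ y ∉ M ∪ M' := by
  obtain ⟨A, hA, e, hτ⟩ := hτ
  obtain ⟨σ, ε, hε, hAv⟩ := signedPerm hA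
  obtain ⟨i, hi⟩ := Function.ne_iff.1 hne
  have hτi : ∀ y, τ y i = e i + ε i * y (σ i) := fun y => by rw [hτ, Pi.add_apply, hAv]
  rw [hτi] at hi
  -- Slicing fixes a coordinate that controls coordinate `i` of `τ y` or of `y`: preferably `i`
  -- itself if it is free in the box, otherwise its source `σ i`. If neither is free, any free
  -- coordinate will do.
  obtain ⟨j, hj, hij, hσj⟩ : ∃ j, s j ≠ 0 ∧ (s i ≠ 0 → j = i) ∧
      (s i = 0 → s (σ i) ≠ 0 → j = σ i) := by
    by_cases h1 : s i = 0
    · by_cases h2 : s (σ i) = 0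
      · have : (Finset.univ.filter fun i => s i ≠ 0).Nonempty := by
          rw [← Finset.card_pos]
          omega
        obtain ⟨j, hj⟩ := this
        exact ⟨j, by simpa using hj, fun h => absurd h1 h, fun _ h => absurd h2 h⟩
      · exact ⟨σ i, h2, fun h => absurd h1 h, fun _ _ => rfl⟩
    · exact ⟨i, h1, fun _ => rfl, fun h => absurd h h1⟩
  -- The level `p` outweighs the translation part and the base point in the relevant coordinates,
  -- the gap `q - p` exceeds the translation, and `K` outweighs both levels.
  obtain ⟨p, hp⟩ : ∃ p, p = |e i| + |a i| + |a (σ i)| + 1 := ⟨_, rfl⟩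
  obtain ⟨q, hq⟩ : ∃ q, q = p + |e i| + 1 := ⟨_, rfl⟩
  obtain ⟨K, hK⟩ : ∃ K, K = p + q := ⟨_, rfl⟩
  have e1 := abs_nonneg (e i)
  have e2 := abs_nonneg (a i)
  have e3 := abs_nonneg (a (σ i))
  have e4 := le_abs_self (e i)
  have e5 := neg_abs_le (e i)
  have e6 := le_abs_self (a i)
  have e7 := neg_abs_le (a i)
  have e8 := le_abs_self (a (σ i))
  have e9 := neg_abs_le (a (σ i))
  refine ⟨slice a s j K p, slice a s j K q, isOrthant_slice hs hj hm K p,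
    isOrthant_slice hs hj hm K q, slice_subset hs j (by omega) (by omega),
    slice_subset hs j (by omega) (by omega), ?_, ?_⟩
  · refine Set.disjoint_left.2 fun y hy hy' => ?_
    have h := (mem_slice_self hy).symm.trans (mem_slice_self hy')
    rcases hs j with h0 | h0 | h0
    · exact hj h0
    · rw [h0] at h
      omega
    · rw [h0] at h
      omega
  · have hmem : ∀ y ∈ slice a s j K p ∪ slice a s j K q,
        (y j = a j + s j * p ∨ y j = a j + s j * q) ∧ ∀ l, l ≠ j →
          (s l = 0 → y l = a l) ∧ (s l = 1 → a l + K ≤ y l) ∧ (s l = -1 → y l ≤ a l - K) := by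
      rintro y (hy | hy)
      · exact ⟨Or.inl (mem_slice_self hy), fun l hl => mem_slice_of_ne hy hl⟩
      · exact ⟨Or.inr (mem_slice_self hy), fun l hl => mem_slice_of_ne hy hl⟩
    intro y hy hz
    obtain ⟨hy1, hy2⟩ := hmem y hy
    obtain ⟨hz1, hz2⟩ := hmem _ hz
    have hzi := hτi y
    have hxi := hx i
    have hxl := hx (σ i)
    by_cases h0 : s i = 0
    · have hji : i ≠ j := fun h => hj (h ▸ h0)
      have h1 := (hz2 i hji).1 h0
      have h2 := hxi.1 h0
      by_cases h3 : s (σ i) = 0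
      -- Both coordinates are constant on the box, so coordinate `i` of `τ y` equals that of `τ x`
      -- and differs from `a i`.
      · have hjl : σ i ≠ j := fun h => hj (h ▸ h3)
        rw [(hy2 _ hjl).1 h3] at hzi
        rw [hxl.1 h3] at hi
        omega
      · obtain rfl := hσj h0 h3
        rcases hs (σ i) with h4 | h4 | h4
        · exact h3 h4
        all_goals
          rw [h4] at hy1
          rcases hε i with h5 | h5 <;> rw [h5] at hzi <;> omega
    · obtain rfl := hij h0
      by_cases hσ : σ j = j
      · rw [hσ] at hzi hi
        rcases hs j with h4 | h4 | h4
        · exact h0 h4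
        all_goals
          rw [h4] at hy1 hz1
          rcases hε j with h5 | h5 <;> rw [h5] at hzi hi <;> omega
      · have hy3 := hy2 _ hσ
        clear hxi hxl hy2 hz2 hy1 hi
        rcases hs j with h4 | h4 | h4
        · exact h0 h4
        all_goals
          rw [h4] at hz1
          rcases hz1 with hz1 | hz1 <;> rcases hε j with h5 | h5 <;> rw [h5] at hzi <;>
            rcases hs (σ j) with h6 | h6 | h6 <;> simp [h6] at hy3 <;> omega

end Orthants

/-! ### Isometric maps of a standard face into `S` -/

section Embeddings

variable {N : ℕ} {S : Set (Fin N → ℤ)} {Y : Finset (Fin N)}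

/-- The isometric embeddings of a standard face into `S`. -/
def embeddings (S : Set (Fin N → ℤ)) (Y : Finset (Fin N)) : Set (face Y → S) :=
  {φ | ∃ τ, IsLatticeIsometry τ ∧ ∀ f, (φ f : Fin N → ℤ) = τ f}

theorem exists_mem_embeddings {L : Set (Fin N → ℤ)} (hL : IsOrthant Y.card L) (hLS : L ⊆ S) :
    ∃ φ ∈ embeddings S Y, ∀ x : S, (x : Fin N → ℤ) ∈ L ↔ ∃ f, φ f = x := by
  obtain ⟨τ, hτ, rfl⟩ := hL.exists_image_face
  refine ⟨fun f => ⟨τ f, hLS ⟨f, f.2, rfl⟩⟩, ⟨τ, hτ, fun f => rfl⟩, fun x => ?_⟩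
  constructor
  · rintro ⟨y, hy, hyx⟩
    exact ⟨⟨y, hy⟩, Subtype.ext hyx⟩
  · rintro ⟨f, rfl⟩
    exact ⟨f, f.2, rfl⟩

theorem isOrthant_of_mem_embeddings {φ : face Y → S} (hφ : φ ∈ embeddings S Y) :
    IsOrthant Y.card (Set.range fun f => (φ f : Fin N → ℤ)) := by
  obtain ⟨τ, hτ, h⟩ := hφ
  refine ⟨τ, hτ, Y, rfl, ?_⟩
  simp only [h]
  ext x
  simp

theorem smul_mem_embeddings {hS : IsOrthohedral S} {g : pei S hS} {φ : face Y → S}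
    (hφ : φ ∈ embeddings S Y) {L : Set (Fin N → ℤ)} (hg : IsometricOn (g : Equiv.Perm S) L)
    (hL : ∀ f, (φ f : Fin N → ℤ) ∈ L) : g • φ ∈ embeddings S Y := by
  obtain ⟨τ, hτ, h⟩ := hφ
  obtain ⟨ρ, hρ, h'⟩ := hg
  refine ⟨ρ ∘ τ, hρ.comp hτ, fun f => ?_⟩
  show ((g : Equiv.Perm S) (φ f) : Fin N → ℤ) = ρ (τ f)
  rw [h' _ (hL f), h]

theorem exists_perm_swap {α F : Type*} {φ ψ : F → α} (hφ : Function.Injective φ)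
    (hψ : Function.Injective ψ) (h : Apart φ ψ) : ∃ t : Equiv.Perm α, IsSwap φ ψ t := by
  classical
  let t : α → α := fun x => if h : ∃ f, φ f = x then ψ h.choose else
    if h : ∃ f, ψ f = x then φ h.choose else x
  have h1 : ∀ f, t (φ f) = ψ f := fun f => by
    have hex : ∃ f', φ f' = φ f := ⟨f, rfl⟩
    simp only [t, dif_pos hex, hφ hex.choose_spec]
  have h2 : ∀ f, t (ψ f) = φ f := fun f => by
    have hex : ∃ f', ψ f' = ψ f := ⟨f, rfl⟩
    have hnex : ¬ ∃ f', φ f' = ψ f := fun ⟨f', hf'⟩ => h f' f hf'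
    simp only [t, dif_neg hnex, dif_pos hex, hψ hex.choose_spec]
  have h3 : ∀ x, (∀ f, φ f ≠ x) → (∀ f, ψ f ≠ x) → t x = x := fun x hx hx' => by
    simp only [t, dif_neg (not_exists.2 hx), dif_neg (not_exists.2 hx')]
  have h4 : Function.Involutive t := fun x => by
    by_cases hx : ∃ f, φ f = x
    · obtain ⟨f, rfl⟩ := hx
      rw [h1, h2]
    by_cases hx' : ∃ f, ψ f = x
    · obtain ⟨f, rfl⟩ := hx'
      rw [h2, h1]
    rw [h3 x (not_exists.1 hx) (not_exists.1 hx'), h3 x (not_exists.1 hx) (not_exists.1 hx')]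
  exact ⟨h4.toPerm, funext h1, funext h2, h3⟩

theorem isometricOn_of_comp_eq {φ ψ : face Y → S} (hφ : φ ∈ embeddings S Y)
    (hψ : ψ ∈ embeddings S Y) {t : Equiv.Perm S} (ht : ∀ f, t (φ f) = ψ f) :
    IsometricOn t (Set.range fun f => (φ f : Fin N → ℤ)) := by
  obtain ⟨τ, hτ, h⟩ := hφ
  obtain ⟨ρ, hρ, h'⟩ := hψ
  obtain ⟨τ', hτ', h1, _⟩ := hτ.exists_inv
  refine ⟨ρ ∘ τ', hρ.comp hτ', ?_⟩
  rintro x ⟨f, hf⟩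
  obtain rfl : φ f = x := Subtype.ext hf
  rw [ht, h', Function.comp_apply, h, h1]

theorem exists_swap_pei (hS : IsOrthohedral S) {φ ψ : face Y → S} (hφ : φ ∈ embeddings S Y)
    (hψ : ψ ∈ embeddings S Y) (h : Apart φ ψ) : ∃ t : pei S hS, IsSwap φ ψ t := by
  have hinj : ∀ {φ : face Y → S}, φ ∈ embeddings S Y → Function.Injective φ := by
    rintro φ ⟨τ, hτ, h⟩ f f' hff
    exact Subtype.ext (hτ.injective (by rw [← h, ← h, hff]))
  obtain ⟨t, ht⟩ := exists_perm_swap (hinj hφ) (hinj hψ) h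
  suffices hp : IsPei t from ⟨⟨t, hp⟩, ht⟩
  set L : Set (Fin N → ℤ) := Set.range fun f => (φ f : Fin N → ℤ)
  set L' : Set (Fin N → ℤ) := Set.range fun f => (ψ f : Fin N → ℤ)
  obtain ⟨Λ, hfin, hΛ, hu⟩ := hS
  -- The grid also respects `L` and `L'`, so every cell lies in `L`, lies in `L'`, or misses both
  -- and is fixed pointwise.
  obtain ⟨C, hC, hCo, hCd, hCu, hCL⟩ := exists_grid (Λ := insert L (insert L' Λ))
    ((hfin.insert _).insert _) (by
      rintro _ (rfl | rfl | hM)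
      · exact ⟨_, isOrthant_of_mem_embeddings hφ⟩
      · exact ⟨_, isOrthant_of_mem_embeddings hψ⟩
      · exact hΛ _ hM)
  refine ⟨{c ∈ C | ∃ M ∈ Λ, c ⊆ M}, hC.subset fun c hc => hc.1, fun c hc => hCo c hc.1,
    hCd.subset fun c hc => hc.1, ?_, ?_⟩
  · rw [← hu]
    ext x
    constructor
    · rintro ⟨c, ⟨_, M, hM, hcM⟩, hx⟩
      exact ⟨M, hM, hcM hx⟩
    · rintro ⟨M, hM, hx⟩
      obtain ⟨c, hc, hxc⟩ : x ∈ ⋃₀ C := hCu ▸ Set.mem_univ x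
      exact ⟨c, ⟨hc, M, hM, hCL c hc M (Or.inr (Or.inr hM)) ⟨x, hxc, hx⟩⟩, hxc⟩
  · rintro c ⟨hc, _⟩
    by_cases h1 : (c ∩ L).Nonempty
    · exact (isometricOn_of_comp_eq hφ hψ fun f => congrFun ht.1 f).mono
        (hCL c hc L (Or.inl rfl) h1)
    by_cases h2 : (c ∩ L').Nonempty
    · exact (isometricOn_of_comp_eq hψ hφ fun f => congrFun ht.2.1 f).mono
        (hCL c hc L' (Or.inr (Or.inl rfl)) h2)
    refine ⟨id, isLatticeIsometry_id, fun x hx => congrArg Subtype.val (ht.2.2 x ?_ ?_)⟩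
    · rintro f rfl
      exact h1 ⟨_, hx, f, rfl⟩
    · rintro f rfl
      exact h2 ⟨_, hx, f, rfl⟩

/-- If `S` contains an orthant of larger rank, then every finite set of embeddings leaves room for
a disjoint one. -/
theorem exists_apart_embedding {L : Set (Fin N → ℤ)} (hL : IsOrthant (Y.card + 1) L)
    (hLS : L ⊆ S) {Φ : Set (face Y → S)} (hΦ : Φ ⊆ embeddings S Y) (hfin : Φ.Finite) :
    ∃ χ ∈ embeddings S Y, ∀ φ ∈ Φ, Apart φ χ := by
  obtain ⟨a, s, hs, hcard, rfl⟩ := hL.exists_box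
  -- A parallel suborthant crossing none of the ranges must miss them all, as its rank is too large
  -- to fit inside one. A facet of it then has the required rank.
  obtain ⟨b, hb, hbΦ⟩ := exists_sub_box
    (Λ := (fun φ : face Y → S => Set.range fun f => (φ f : Fin N → ℤ)) '' Φ) (hfin.image _) (by
      rintro _ ⟨φ, hφ, rfl⟩
      exact ⟨_, isOrthant_of_mem_embeddings (hΦ hφ)⟩) a hs
  obtain ⟨j, hj⟩ : (Finset.univ.filter fun i => s i ≠ 0).Nonempty := by
    rw [← Finset.card_pos]
    omega
  have hsub := slice_subset (a := b) hs j le_rfl le_rfl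
  obtain ⟨χ, hχ, hχL⟩ := exists_mem_embeddings (S := S)
    (isOrthant_slice (a := b) hs (by simpa using hj) hcard 0 0)
    ((hsub.trans (box_subset hs hb)).trans hLS)
  refine ⟨χ, hχ, fun φ hφ f f' hff => ?_⟩
  have h := (isOrthant_box b hs).rank_le (isOrthant_of_mem_embeddings (hΦ hφ))
    (hbΦ _ ⟨φ, hφ, rfl⟩ ⟨φ f, hsub ((hχL _).2 ⟨f', hff.symm⟩), f, rfl⟩)
  omega

/-- Take `φ` parametrising `L` and set `ψ = t • φ`. Its range is all of `L'`, because `t` maps `L'`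
into `L` and is an involution there. -/
theorem IsOrthantTransposition.exists_isSwap {hS : IsOrthohedral S} {t : pei S hS}
    (ht : IsOrthantTransposition Y.card (t : Equiv.Perm S)) :
    ∃ φ ∈ embeddings S Y, ∃ ψ ∈ embeddings S Y, Apart φ ψ ∧ IsSwap φ ψ t := by
  obtain ⟨L, L', hL, hL', hLS, hLS', hd, hiso, h1, h2, h3, h4⟩ := ht
  obtain ⟨φ, hφ, hφL⟩ := exists_mem_embeddings hL hLS
  have hmem : ∀ f, (φ f : Fin N → ℤ) ∈ L := fun f => (hφL _).2 ⟨f, rfl⟩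
  refine ⟨φ, hφ, t • φ, smul_mem_embeddings hφ hiso hmem, fun f f' hff => ?_, rfl,
    funext fun f => h3 _ (Or.inl (hmem f)), fun x hx hx' => h4 x ?_⟩
  · refine Set.disjoint_left.1 hd (hmem f) ?_
    rw [hff]
    exact h1 _ (hmem f')
  · rintro (h | h)
    · obtain ⟨f, hf⟩ := (hφL x).1 h
      exact hx f hf
    · obtain ⟨f, hf⟩ := (hφL _).1 (h2 x h)
      refine hx' f ?_
      show (t : Equiv.Perm S) (φ f) = x
      rw [hf, h3 x (Or.inr h)]

end Embeddings

/-! ### Normal subgroups -/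

section Normal

variable {N : ℕ} {S : Set (Fin N → ℤ)} {hS : IsOrthohedral S}

theorem bddAbove_rkElt (H : Subgroup (pei S hS)) : BddAbove {r : ℤ | ∃ g ∈ H, r = rkElt g} := by
  refine ⟨N, ?_⟩
  rintro _ ⟨g, _, rfl⟩
  exact (rk_le_iff (by omega)).2 fun r L hL _ => by exact_mod_cast hL.le

theorem exists_rkElt_eq (H : Subgroup (pei S hS)) : ∃ g ∈ H, rkElt g = rkSubgroup H := by
  obtain ⟨g, hg, h⟩ := Int.csSup_mem (s := {r : ℤ | ∃ g ∈ H, r = rkElt g})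
    ⟨_, 1, one_mem H, rfl⟩ (bddAbove_rkElt H)
  exact ⟨g, hg, h.symm⟩

/-- The rank of an element is the rank of an orthant on which it is a non-trivial isometric
embedding. -/
theorem exists_orthant_of_rkElt_eq {g : pei S hS} {k : ℕ} (hg : rkElt g = k) :
    ∃ L, IsOrthant k L ∧ L ⊆ S ∧ IsometricOn (g : Equiv.Perm S) L ∧
      ∃ x : S, (x : Fin N → ℤ) ∈ L ∧ (g : Equiv.Perm S) x ≠ x := by
  -- An orthant of maximal rank in the support need not be one on which `g` is isometric, since the
  -- support is only a union of such orthants. The criterion `IsPei.rk_supp_le_iff` at `k - 1`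
  -- supplies one of rank at least `k`.
  have h : ¬ rk (supp (g : Equiv.Perm S)) ≤ (k : ℤ) - 1 := by
    have : rk (supp (g : Equiv.Perm S)) = k := hg
    omega
  rw [IsPei.rk_supp_le_iff g.2 (by omega)] at h
  push Not at h
  obtain ⟨r, L, hL, hLS, hiso, hr, x, hx, hne⟩ := h
  have hle := (rk_le_iff (T := supp (g : Equiv.Perm S)) (k := k) (by omega)).1 hg.le r L hL
    (Set.subset_sUnion_of_mem ⟨⟨r, hL⟩, hLS, hiso, x, hx, hne⟩)
  obtain rfl : r = k := by omega
  exact ⟨L, hL, hLS, hiso, x, hx, hne⟩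

/-- The same rank-`m + 1` orthant serves twice: its slices are the maps that an element of `H` moves
off themselves, and it provides room for fresh embeddings. -/
theorem transposition_mul_mem {H : Subgroup (pei S hS)} (hH : H.Normal) {m : ℕ}
    (hk : rkSubgroup H = m + 1) {t u : pei S hS}
    (ht : IsOrthantTransposition m (t : Equiv.Perm S))
    (hu : IsOrthantTransposition m (u : Equiv.Perm S)) : t * u ∈ H := by
  obtain ⟨g, hgH, hg⟩ := exists_rkElt_eq H
  obtain ⟨L, hL, hLS, hiso, x, hx, hne⟩ := exists_orthant_of_rkElt_eq
    (g := g) (k := m + 1) (by rw [hg, hk]; push_cast; rfl)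
  obtain ⟨Y, rfl⟩ : ∃ Y : Finset (Fin N), Y.card = m := by
    obtain ⟨_, _, ⟨_, _, Y, hY, _⟩, _⟩ := ht
    exact ⟨Y, hY⟩
  obtain ⟨a, s, hs, hcard, rfl⟩ := hL.exists_box
  obtain ⟨τ, hτ, hgτ⟩ := hiso
  obtain ⟨M, M', hM, hM', hML, hML', hd, hoff⟩ := exists_slices hs hcard hτ hx
    (fun h => hne (Subtype.ext ((hgτ x hx).trans h)))
  obtain ⟨φ, hφ, hφM⟩ := exists_mem_embeddings hM (hML.trans hLS)
  obtain ⟨ψ, hψ, hψM⟩ := exists_mem_embeddings hM' (hML'.trans hLS)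
  have hφm : ∀ f, (φ f : Fin N → ℤ) ∈ M := fun f => (hφM _).2 ⟨f, rfl⟩
  have hψm : ∀ f, (ψ f : Fin N → ℤ) ∈ M' := fun f => (hψM _).2 ⟨f, rfl⟩
  have hap : ∀ {θ χ : face Y → S}, (∀ f, (θ f : Fin N → ℤ) ∈ M ∪ M') →
      (∀ f, (χ f : Fin N → ℤ) ∈ M ∪ M') → Apart (g • θ) χ := by
    intro θ χ hθ hχ f f' hff
    refine hoff _ (hθ f) ?_
    rw [← hgτ _ (Set.union_subset hML hML' (hθ f))]
    have h1 : (g : Equiv.Perm S) (θ f) = χ f' := hff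
    rw [h1]
    exact hχ f'
  obtain ⟨φ₁, hφ₁, φ₂, hφ₂, hφa, ht⟩ := ht.exists_isSwap
  obtain ⟨ψ₁, hψ₁, ψ₂, hψ₂, hψa, hu⟩ := hu.exists_isSwap
  exact IsSwap.mul_mem_of_normal (V := embeddings S Y)
    (fun _ h _ h' => exists_swap_pei hS h h') (fun _ => exists_apart_embedding hL hLS) hH hgH
    hφ hψ (smul_mem_embeddings hφ ⟨τ, hτ, hgτ⟩ fun f => hML (hφm f))
    (smul_mem_embeddings hψ ⟨τ, hτ, hgτ⟩ fun f => hML' (hψm f))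
    (fun f f' hff => Set.disjoint_left.1 hd (hφm f) (hff ▸ hψm f'))
    (hap (fun f => Or.inl (hφm f)) fun f => Or.inl (hφm f))
    (hap (fun f => Or.inl (hφm f)) fun f => Or.inr (hψm f))
    (hap (fun f => Or.inr (hψm f)) fun f => Or.inl (hφm f))
    (hap (fun f => Or.inr (hψm f)) fun f => Or.inr (hψm f))
    hφ₁ hφ₂ hψ₁ hψ₂ hφa hψa ht hu

/-- An even product of elements any two of which have their product in a subgroup lies in that
subgroup. -/
theorem prod_mem_of_even_length {G : Type*} [Group G] {H : Subgroup G} {P : G → Prop}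
    (hP : ∀ t u, P t → P u → t * u ∈ H) :
    ∀ l : List G, Even l.length → (∀ t ∈ l, P t) → l.prod ∈ H
  | [], _, _ => one_mem H
  | [_], h, _ => by simp at h
  | t :: u :: l, h, hl => by
    rw [List.prod_cons, List.prod_cons, ← mul_assoc]
    refine mul_mem (hP t u (hl t (by simp)) (hl u (by simp)))
      (prod_mem_of_even_length hP l ?_ fun v hv => hl v (by simp [hv]))
    simpa [Nat.even_add_one] using h

end Normal

end Pei

theorem mainTheorem6 {N : ℕ} (S : Set (Fin N → ℤ)) (hS : Pei.IsOrthohedral S)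
    (H : Subgroup (Pei.pei S hS)) (hH : H.Normal) (k : ℤ) (hk : Pei.rkSubgroup H = k) :
    Pei.altRankSubgroup S hS (k - 1) ≤ H ∧ H ≤ Pei.rankSubgroup S hS k := by
  constructor
  · rintro _ ⟨_, l, hl, hlt, rfl⟩
    -- For `k ≤ 0` no natural number equals `k - 1`, so the pairwise condition is vacuous and the
    -- list is empty.
    refine Pei.prod_mem_of_even_length ?_ l hl hlt
    rintro t u ⟨r, hr, ht⟩ ⟨r', hr', hu⟩
    obtain rfl : r = r' := by omega
    exact Pei.transposition_mul_mem hH (by omega) ht hu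
  · intro g hg
    have h : Pei.rkElt g ≤ Pei.rkSubgroup H := le_csSup (Pei.bddAbove_rkElt H) ⟨g, hg, rfl⟩
    exact le_max_of_le_left (hk ▸ h)
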